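/- Let $F$ be a totally real number field, $I$ the set of its real embeddings, $\mathcal O$ its ring of integers, $\mathbb A=\mathbb A_\infty\times\mathbb A_f$ its ring of adeles, with $\mathbb A_\infty$ identified with $\mathbb R^I$, and $\hat{\mathcal O}\subset\mathbb A_f$ the profinite completion of $\mathcal O$. Write $|\cdot|$ for the idele norm and fix a Haar measure $\mathrm d^\times t$ on $\mathbb A^\times/F^\times$. Let $\mathcal S(\mathbb A^2)$ be the space of Schwartz–Bruhat functions, i.e. the complex span of the functions $x\mapsto\varphi_f(x_f)\varphi_\infty(x_\infty)$ with $\varphi_f$ locally constant of compact support on $\mathbb A_f^2$ and $\varphi_\infty$ a Schwartz function on $(\mathbb R^I)^2$. The group $\mathrm{GL}_2(\mathbb A)$ acts on functions on $\mathbb A^2$ by $(g\varphi)(v)=\varphi(g^{-1}v)$. For $\varphi\in\mathcal S(\mathbb A^2)$, a unitary Hecke character $\omega$ (a continuous character $\mathbb A^\times/F^\times\to\{z\in\mathbb C:|z|=1\}$), $s\in\mathbb C$ and $g\in\mathrm{GL}_2(\mathbb A)$, put $$\Theta(\varphi)(g)=\sum_{v\in F^2\setminus\{0\}}(g\varphi)(v),\qquad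 E^{\rm ana}_{\omega,s}(\varphi)(g)=|\det g|^{-s}\int_{\mathbb A^\times/F^\times}\omega(t)\,|t|^{2s}\,\Theta(\varphi)(g/t)\,\mathrm d^\times t ,$$ the integral being taken for $\operatorname{Re}s>1$, where it converges absolutely; for the other $s$, $E^{\rm ana}_{\omega,s}(\varphi)(g)$ denotes the meromorphic continuation in $s$ (by convention with value $0$ at a pole). Let $\varphi\in\mathcal S(\mathbb A^2)$. Then: 1. (Left invariance.) For all $\omega$, $s$, $\gamma\in\mathrm{GL}_2(F)$ and $g\in\mathrm{GL}_2(\mathbb A)$: $E^{\rm ana}_{\omega,s}(\varphi)(\gamma g)=E^{\rm ana}_{\omega,s}(\varphi)(g)$. 2. (Central character.) For all $\omega$, $s$, $z\in\mathbb A^\times$ and $g\in\mathrm{GL}_2(\mathbb A)$: $E^{\rm ana}_{\omega,s}(\varphi)(zg)=\omega(z)\,E^{\rm ana}_{\omega,s}(\varphi)(g)$. 3. (Weights.) If $\varphi=\varphi_f\times\prod_{\iota\in I}\varphi_\iota$ for a function $\varphi_f$ on $\mathbb A_f^2$ and $\varphi_\iota(v_1,v_2)=\exp(-\pi(v_1^2+v_2^2))(v_1+iv_2)^{k_\iota}$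 with $k_\iota\in\mathbb N$, then for all $\omega$, $s$, $g\in\mathrm{GL}_2(\mathbb A)$ and all real $(\theta_\iota)_{\iota\in I}$ $$E^{\rm ana}_{\omega,s}(\varphi)(g\rho)=\Big(\prod_{\iota\in I}e^{ik_\iota\theta_\iota}\Big)E^{\rm ana}_{\omega,s}(\varphi)(g),$$ where $\rho\in\mathrm{GL}_2(\mathbb A)$ has trivial finite part and components $\begin{pmatrix}\cos\theta_\iota&\sin\theta_\iota\\-\sin\theta_\iota&\cos\theta_\iota\end{pmatrix}$ at the $\iota\in I$. 4. (Level.) There is a subgroup $K$ of finite index in $\mathrm{GL}_2(\hat{\mathcal O})$, depending only on $\varphi$, such that for all $\omega$, $s$, $h\in K$ (seen in $\mathrm{GL}_2(\mathbb A)$ with trivial archimedean components) and $g\in\mathrm{GL}_2(\mathbb A)$: $E^{\rm ana}_{\omega,s}(\varphi)(gh)=E^{\rm ana}_{\omega,s}(\varphi)(g)$. -/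

import Mathlib

open NumberField IsDedekindDomain MeasureTheory

noncomputable section

/-- The ring of adeles `A` of the number field `F`. -/
abbrev Adele (F : Type*) [Field F] [NumberField F] : Type _ :=
  AdeleRing (𝓞 F) F

/-- The ring of finite adeles `A_f` of the number field `F`. -/
abbrev FinAdele (F : Type*) [Field F] [NumberField F] : Type _ :=
  FiniteAdeleRing (𝓞 F) F

/-- The group of ideles `Aˣ`, with its topology as the unit group of the topological ring `A`. -/
abbrev Idele (F : Type*) [Field F] [NumberField F] : Type _ :=
  (Adele F)ˣ

/-! ### The idele norm and the idele class group -/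

section IdeleNorm

variable (F : Type*) [Field F] [NumberField F]

theorem Idele.finite_mulSupport (t : Idele F) :
    (fun v : HeightOneSpectrum (𝓞 F) =>
      ‖((t : Adele F).2 : FinAdele F) v‖).HasFiniteMulSupport := by
  have hu : IsUnit ((t : Adele F).2 : FinAdele F) := by
    refine ⟨⟨(t : Adele F).2, ((t⁻¹ : Idele F) : Adele F).2, ?_, ?_⟩, rfl⟩
    · exact congrArg Prod.snd t.mul_inv
    · exact congrArg Prod.snd t.inv_mul
  have h := (FiniteAdeleRing.isUnit_iff.1 hu).2
  rw [Filter.eventually_cofinite] at h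
  refine h.subset fun v hv hv1 => hv ?_
  simp [FinitePlace.norm_def, hv1]

/-- The idele norm `|t| = ∏_v |t_v|_v`, the product running over all places of `F`, with the
normalized absolute values (at the infinite places, `‖x‖ = ∏ v, ‖x v‖ ^ v.mult`; at the finite
places, a uniformizer at `v` has norm `(N v)⁻¹`). -/
def ideleNorm : Idele F →* ℝ where
  toFun t := ‖((t : Adele F).1 : InfiniteAdeleRing F)‖ *
    ∏ᶠ v : HeightOneSpectrum (𝓞 F), ‖((t : Adele F).2 : FinAdele F) v‖
  map_one' := by
    have h1 : ∀ v : HeightOneSpectrum (𝓞 F), ‖(((1 : Idele F) : Adele F).2 : FinAdele F) v‖ = 1 :=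
      fun v => norm_one (α := v.adicCompletion F)
    have h2 : ∀ v : InfinitePlace F, ‖(((1 : Idele F) : Adele F).1 : InfiniteAdeleRing F) v‖ = 1 :=
      fun v => norm_one (α := v.Completion)
    simp only [h1, InfiniteAdeleRing.norm_def, h2]
    simp
  map_mul' s t := by
    have h1 : ∀ v : HeightOneSpectrum (𝓞 F), ‖(((s * t : Idele F) : Adele F).2 : FinAdele F) v‖ =
        ‖((s : Adele F).2 : FinAdele F) v‖ * ‖((t : Adele F).2 : FinAdele F) v‖ :=
      fun v => norm_mul (α := v.adicCompletion F) _ _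
    have h2 : ∀ v : InfinitePlace F, ‖(((s * t : Idele F) : Adele F).1 : InfiniteAdeleRing F) v‖ =
        ‖((s : Adele F).1 : InfiniteAdeleRing F) v‖ *
          ‖((t : Adele F).1 : InfiniteAdeleRing F) v‖ :=
      fun v => norm_mul (α := v.Completion) _ _
    simp only [h1, InfiniteAdeleRing.norm_def, h2]
    rw [finprod_mul_distrib (Idele.finite_mulSupport F s) (Idele.finite_mulSupport F t)]
    simp only [mul_pow, Finset.prod_mul_distrib]
    ring

/-- The diagonal embedding `Fˣ → Aˣ`. -/
def principalIdele : Fˣ →* Idele F := Units.map (algebraMap F (Adele F) : F →* Adele F)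

/-- The product formula. -/
theorem ideleNorm_principalIdele (x : Fˣ) : ideleNorm F (principalIdele F x) = 1 := by
  have h := prod_abs_eq_one (K := F) (x := (x : F)) x.ne_zero
  rw [← h]
  change ‖algebraMap F (InfiniteAdeleRing F) (x : F)‖ *
    ∏ᶠ v : HeightOneSpectrum (𝓞 F), ‖FinitePlace.embedding v (x : F)‖ = _
  rw [InfiniteAdeleRing.coe_norm_eq_abs_norm, InfinitePlace.prod_eq_abs_norm]
  congr 1
  rw [← finprod_comp_equiv (FinitePlace.equivHeightOneSpectrum (K := F)).symm]
  simp [FinitePlace.equivHeightOneSpectrum_symm_apply]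

/-- The idele class group `Aˣ / Fˣ`. -/
def IdeleClassGroup : Type _ := Idele F ⧸ (principalIdele F).range

instance : CommGroup (IdeleClassGroup F) :=
  inferInstanceAs (CommGroup (Idele F ⧸ (principalIdele F).range))

instance : TopologicalSpace (IdeleClassGroup F) :=
  inferInstanceAs (TopologicalSpace (Idele F ⧸ (principalIdele F).range))

instance : IsTopologicalGroup (IdeleClassGroup F) :=
  inferInstanceAs (IsTopologicalGroup (Idele F ⧸ (principalIdele F).range))

instance : MeasurableSpace (IdeleClassGroup F) := borel _

instance : BorelSpace (IdeleClassGroup F) := ⟨rfl⟩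

/-- The projection `Aˣ → Aˣ / Fˣ`. -/
def ideleClass : Idele F →* IdeleClassGroup F := QuotientGroup.mk' (principalIdele F).range

end IdeleNorm

/-- Unitary Hecke characters: the continuous characters `Aˣ / Fˣ → {z ∈ ℂ : |z| = 1}`. -/
abbrev UnitaryHeckeCharacter (F : Type*) [Field F] [NumberField F] : Type _ :=
  IdeleClassGroup F →ₜ* Circle

/-! ### Matrices over the adeles -/

section Matrices

open Matrix

/-- The element of `GL₂(R × S)` with given components in `GL₂(R)` and `GL₂(S)`. -/
def glProd {R S : Type*} [CommRing R] [CommRing S] (g : GL (Fin 2) R) (h : GL (Fin 2) S) :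
    GL (Fin 2) (R × S) where
  val := Matrix.of fun i j => (g.1 i j, h.1 i j)
  inv := Matrix.of fun i j => (g.2 i j, h.2 i j)
  val_inv := by
    have h1 := g.3
    have h2 := h.3
    ext i j
    · have := congrFun (congrFun h1 i) j
      fin_cases i <;> fin_cases j <;> simpa [Matrix.mul_apply] using! this
    · have := congrFun (congrFun h2 i) j
      fin_cases i <;> fin_cases j <;> simpa [Matrix.mul_apply] using! this
  inv_val := by
    have h1 := g.4
    have h2 := h.4
    ext i j
    · have := congrFun (congrFun h1 i) j
      fin_cases i <;> fin_cases j <;> simpa [Matrix.mul_apply] using! this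
    · have := congrFun (congrFun h2 i) j
      fin_cases i <;> fin_cases j <;> simpa [Matrix.mul_apply] using! this

variable (F : Type*) [Field F] [NumberField F]

/-- The element of `GL₂(A)` with given infinite and finite parts. -/
def glAdele (g : GL (Fin 2) (InfiniteAdeleRing F)) (h : GL (Fin 2) (FinAdele F)) :
    GL (Fin 2) (Adele F) :=
  glProd g h

/-- The embedding `GL₂(F) → GL₂(A)`. -/
def glDiag : GL (Fin 2) F →* GL (Fin 2) (Adele F) :=
  Matrix.GeneralLinearGroup.map (algebraMap F (Adele F))

/-- The ring `Ô` of integral finite adeles, the product of the completions of `𝓞 F`. -/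
abbrev IntAdele : Type _ :=
  (v : HeightOneSpectrum (𝓞 F)) → v.adicCompletionIntegers F

/-- The inclusion `Ô → A_f`. -/
def intAdeleIncl : IntAdele F →+* FinAdele F where
  toFun x := ⟨fun v => (x v : v.adicCompletion F), Filter.Eventually.of_forall fun v => (x v).2⟩
  map_one' := rfl
  map_mul' _ _ := rfl
  map_zero' := rfl
  map_add' _ _ := rfl

/-- The embedding `GL₂(Ô) → GL₂(A)`, with identity components at the infinite places. -/
def glInt (h : GL (Fin 2) (IntAdele F)) : GL (Fin 2) (Adele F) :=
  glAdele F 1 (Matrix.GeneralLinearGroup.map (intAdeleIncl F) h)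

/-- The identification `A_∞ ≃ ℝ^I` for `F` totally real; the set `I` of real embeddings of `F` is
identified with the set of infinite places of `F`. -/
def infAdeleEquiv [IsTotallyReal F] : InfiniteAdeleRing F ≃+* (InfinitePlace F → ℝ) :=
  RingEquiv.piCongrRight fun v : InfinitePlace F =>
    InfinitePlace.Completion.ringEquivRealOfIsReal (IsTotallyReal.isReal v)

/-- The element of `GL₂(ℝ^I)` with components the rotation matrices
`(cos θ_ι, sin θ_ι; -sin θ_ι, cos θ_ι)`. -/
def rotationReal {I : Type*} (θ : I → ℝ) : GL (Fin 2) (I → ℝ) :=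
  Matrix.GeneralLinearGroup.mk''
    !![fun ι => Real.cos (θ ι), fun ι => Real.sin (θ ι);
      fun ι => -Real.sin (θ ι), fun ι => Real.cos (θ ι)]
    (by
      have h : Matrix.det !![fun ι => Real.cos (θ ι), fun ι => Real.sin (θ ι);
          fun ι => -Real.sin (θ ι), fun ι => Real.cos (θ ι)] = (1 : I → ℝ) := by
        rw [Matrix.det_fin_two_of]
        ext ι
        simp only [Pi.sub_apply, Pi.mul_apply, Pi.one_apply]
        nlinarith [Real.sin_sq_add_cos_sq (θ ι)]
      rw [h]
      exact isUnit_one)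

/-- The rotation `ρ ∈ GL₂(A)` of angles `(θ_ι)_{ι ∈ I}`, with identity finite part. -/
def adelicRotation [IsTotallyReal F] (θ : InfinitePlace F → ℝ) : GL (Fin 2) (Adele F) :=
  glAdele F
    (Matrix.GeneralLinearGroup.map ((infAdeleEquiv F).symm : (InfinitePlace F → ℝ) →+* _)
      (rotationReal θ)) 1

end Matrices

/-! ### Schwartz-Bruhat functions on `A²` -/

section SchwartzBruhat

variable (F : Type*) [Field F] [NumberField F]

/-- The finite part of a vector of `A²`. -/
def finPart (x : Fin 2 → Adele F) : Fin 2 → FinAdele F := fun j => (x j).2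

/-- The infinite part of a vector of `A²`, as an element of `(ℝ^I)²`. -/
def infPart [IsTotallyReal F] (x : Fin 2 → Adele F) : Fin 2 → InfinitePlace F → ℝ :=
  fun j => infAdeleEquiv F (x j).1

/-- The space `S(A²)` of Schwartz-Bruhat functions: the span of the functions
`x ↦ φ_f(x_f) φ_∞(x_∞)`, where `φ_f` is locally constant with compact support, and `φ_∞` is
smooth and rapidly decreasing together with all its derivatives. -/
def SchwartzBruhat [IsTotallyReal F] : Submodule ℂ ((Fin 2 → Adele F) → ℂ) :=
  Submodule.span ℂ
    {φ | ∃ (φf : (Fin 2 → FinAdele F) → ℂ) (φinf : SchwartzMap (Fin 2 → InfinitePlace F → ℝ) ℂ),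
      IsLocallyConstant φf ∧ HasCompactSupport φf ∧
        φ = fun x => φf (finPart F x) * φinf (infPart F x)}

/-- The function `φ_f × ∏_ι φ_ι` on `A²`, with
`φ_ι(v₁, v₂) = exp(-π(v₁² + v₂²)) (v₁ + i v₂)^{k_ι}`. -/
def weightFunction [IsTotallyReal F] (φf : (Fin 2 → FinAdele F) → ℂ) (k : InfinitePlace F → ℕ) :
    (Fin 2 → Adele F) → ℂ := fun x =>
  φf (finPart F x) * ∏ ι : InfinitePlace F,
    (Real.exp (-Real.pi * ((infPart F x 0 ι) ^ 2 + (infPart F x 1 ι) ^ 2)) : ℂ) *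
      ((infPart F x 0 ι : ℂ) + Complex.I * (infPart F x 1 ι : ℂ)) ^ k ι

end SchwartzBruhat

/-! ### The Eisenstein series -/

section Eisenstein

open Matrix

variable {F : Type*} [Field F] [NumberField F]

/-- The action of `GL₂(A)` on functions on `A²`: `(g φ)(v) = φ(g⁻¹ v)`. -/
def glAct (g : GL (Fin 2) (Adele F)) (φ : (Fin 2 → Adele F) → ℂ) : (Fin 2 → Adele F) → ℂ :=
  fun x => φ (((g⁻¹ : GL (Fin 2) (Adele F)) : Matrix (Fin 2) (Fin 2) (Adele F)) *ᵥ x)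

/-- The embedding `F² → A²`. -/
def vecDiag (v : Fin 2 → F) : Fin 2 → Adele F := fun j => algebraMap F (Adele F) (v j)

/-- The theta function `Θ(φ)(g) = ∑_{v ∈ F² \ {0}} (g φ)(v)`. -/
def theta (φ : (Fin 2 → Adele F) → ℂ) (g : GL (Fin 2) (Adele F)) : ℂ :=
  ∑' v : {v : Fin 2 → F // v ≠ 0}, glAct g φ (vecDiag v.1)

theorem theta_mul_scalar_principal (φ : (Fin 2 → Adele F) → ℂ) (g : GL (Fin 2) (Adele F))
    (x : Fˣ) :
    theta φ (g * Matrix.GeneralLinearGroup.scalar (Fin 2) (principalIdele F x)⁻¹) = theta φ g := by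
  let e : {v : Fin 2 → F // v ≠ 0} ≃ {v : Fin 2 → F // v ≠ 0} :=
    { toFun := fun v => ⟨(x : F) • v.1, smul_ne_zero x.ne_zero v.2⟩
      invFun := fun v => ⟨((x⁻¹ : Fˣ) : F) • v.1, smul_ne_zero (x⁻¹).ne_zero v.2⟩
      left_inv := fun v => by ext j; simp
      right_inv := fun v => by ext j; simp }
  unfold theta
  rw [← e.tsum_eq fun v : {v : Fin 2 → F // v ≠ 0} => glAct g φ (vecDiag v.1)]
  refine tsum_congr fun v => ?_
  unfold glAct
  congr 1
  have h : vecDiag (F := F) (e v).1 =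
      (algebraMap F (Adele F) (x : F)) • vecDiag (F := F) v.1 := by
    ext1 j
    simp [vecDiag, e]
  rw [h, _root_.mul_inv_rev, ← map_inv, inv_inv]
  rw [Units.val_mul, ← Matrix.mulVec_mulVec, Matrix.mulVec_smul]
  ext1 j
  fin_cases j <;>
    simp [principalIdele, Matrix.mulVec, dotProduct, Matrix.scalar_apply, Matrix.diagonal_apply,
      Fin.sum_univ_two]

/-- The integrand `ω(t) |t|^{2s} Θ(φ)(g/t)`, as a function on `Aˣ`. -/
def eisIntegrandIdele (ω : UnitaryHeckeCharacter F) (s : ℂ) (φ : (Fin 2 → Adele F) → ℂ)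
    (g : GL (Fin 2) (Adele F)) (t : Idele F) : ℂ :=
  (ω (ideleClass F t) : ℂ) * ((ideleNorm F t : ℝ) : ℂ) ^ (2 * s) *
    theta φ (g * Matrix.GeneralLinearGroup.scalar (Fin 2) t⁻¹)

theorem eisIntegrandIdele_mul_principal (ω : UnitaryHeckeCharacter F) (s : ℂ)
    (φ : (Fin 2 → Adele F) → ℂ) (g : GL (Fin 2) (Adele F)) (t : Idele F) (x : Fˣ) :
    eisIntegrandIdele ω s φ g (t * principalIdele F x) = eisIntegrandIdele ω s φ g t := by
  have h1 : ideleClass F (t * principalIdele F x) = ideleClass F t :=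
    (QuotientGroup.eq.2 (by simp)).symm
  unfold eisIntegrandIdele
  rw [h1, map_mul (ideleNorm F), ideleNorm_principalIdele, mul_one, _root_.mul_inv_rev,
    mul_comm (principalIdele F x)⁻¹, map_mul, ← mul_assoc, theta_mul_scalar_principal]

/-- The integrand `ω(t) |t|^{2s} Θ(φ)(g/t)`, as a function on `Aˣ / Fˣ`. -/
def eisIntegrand (ω : UnitaryHeckeCharacter F) (s : ℂ) (φ : (Fin 2 → Adele F) → ℂ)
    (g : GL (Fin 2) (Adele F)) : IdeleClassGroup F → ℂ :=
  Quotient.lift (eisIntegrandIdele ω s φ g) (by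
    intro a b hab
    obtain ⟨x, hx⟩ := QuotientGroup.leftRel_apply.1 hab
    have hb : b = a * principalIdele F x := by rw [hx]; simp
    rw [hb, eisIntegrandIdele_mul_principal])

/-- The integral `|det g|^{-s} ∫_{Aˣ/Fˣ} ω(t) |t|^{2s} Θ(φ)(g/t) dˣt`, where `μ` is the chosen
Haar measure `dˣt` on `Aˣ / Fˣ`. It converges absolutely for `Re s > 1`. -/
def eisIntegral (μ : Measure (IdeleClassGroup F)) (ω : UnitaryHeckeCharacter F) (s : ℂ)
    (φ : (Fin 2 → Adele F) → ℂ) (g : GL (Fin 2) (Adele F)) : ℂ :=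
  ((ideleNorm F (Matrix.GeneralLinearGroup.det g) : ℝ) : ℂ) ^ (-s) *
    ∫ t : IdeleClassGroup F, eisIntegrand ω s φ g t ∂μ

/-- `G` is the meromorphic continuation to `ℂ` of the restriction of `f` to the half-plane
`Re s > 1`. The normal form condition says that `G` is analytic, except at its poles, where it
takes the value `0`; so there is at most one such `G`. -/
def IsMeromorphicContinuation (f G : ℂ → ℂ) : Prop :=
  MeromorphicNFOn G Set.univ ∧ ∀ s : ℂ, 1 < s.re → G s = f s

theorem IsMeromorphicContinuation.unique {f G H : ℂ → ℂ} (hG : IsMeromorphicContinuation f G)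
    (hH : IsMeromorphicContinuation f H) : G = H := by
  have hG1 : ∀ x, MeromorphicAt G x := fun x => (hG.1 (Set.mem_univ x)).meromorphicAt
  have hH1 : ∀ x, MeromorphicAt H x := fun x => (hH.1 (Set.mem_univ x)).meromorphicAt
  have hm : MeromorphicOn (G - H) Set.univ := fun x _ => (hG1 x).sub (hH1 x)
  have h2 : meromorphicOrderAt (G - H) 2 = ⊤ := by
    rw [meromorphicOrderAt_eq_top_iff]
    have ho : IsOpen {s : ℂ | 1 < s.re} := isOpen_lt continuous_const Complex.continuous_re
    filter_upwards [nhdsWithin_le_nhds (ho.mem_nhds (by norm_num : (1 : ℝ) < (2 : ℂ).re))] with s hs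
    simp [hG.2 s hs, hH.2 s hs]
  funext x
  have hx : meromorphicOrderAt (G - H) x = ⊤ := by
    by_contra hne
    exact (hm.meromorphicOrderAt_ne_top_of_isPreconnected isPreconnected_univ
      (Set.mem_univ x) (Set.mem_univ 2) hne) h2
  rw [meromorphicOrderAt_eq_top_iff] at hx
  refine (((hG.1 (Set.mem_univ x)).eventuallyEq_nhdsNE_iff_eventuallyEq_nhds
    (hH.1 (Set.mem_univ x))).1 ?_).eq_of_nhds
  filter_upwards [hx] with s hs
  exact sub_eq_zero.1 hs

open Classical in
/-- The Eisenstein series `E^{ana}_{ω,s}(φ)`: the integral `eisIntegral` on the half-plane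
`Re s > 1` of absolute convergence, and its meromorphic continuation in `s` elsewhere. -/
def eisAna (μ : Measure (IdeleClassGroup F)) (ω : UnitaryHeckeCharacter F) (s : ℂ)
    (φ : (Fin 2 → Adele F) → ℂ) (g : GL (Fin 2) (Adele F)) : ℂ :=
  if 1 < s.re then eisIntegral μ ω s φ g
  else if h : ∃ G : ℂ → ℂ, IsMeromorphicContinuation (fun z => eisIntegral μ ω z φ g) G then
    Classical.choose h s
  else 0

end Eisenstein

end

/-! Each assertion has the form E(g') = c E(g) with a nonzero constant c independent of s. It is
enough to prove it for the integral, at every s: meromorphic continuations in normal form are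
unique, so the relation passes to them (`eisAna_eq_mul_of_eisIntegral`). Convergence and existence
of the continuation are never needed, since reindexing, invariance of the measure and extraction of
constants also hold for divergent sums and integrals with their default value 0.

For the integral: γ in GL₂(F) permutes F² \ {0} and |det γ| = 1 by the product formula. A scalar z
is absorbed by the substitution t ↦ zt, which produces ω(z)|z|^{2s}, and |det z|^{-s} = |z|^{-2s}
cancels the norm (`eisIntegral_scalar_mul`). Scalars being central, right translation by h replaces
φ by hφ; if hφ = cφ and |det h| = 1, the factor c comes out (`eisAna_mul_right`). For a rotation
this is a computation with v₁ + iv₂. For the level, the stabilizer of φ_f in the compact group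
GL₂(Ô) is open, hence of finite index (`exists_finiteIndex_glAct_glInt`). -/

open NumberField IsDedekindDomain MeasureTheory

noncomputable section

/-! ### Proportionality and meromorphic continuation -/

section Continuation

variable {F : Type*} [Field F] [NumberField F]

/-- A nonzero constant is analytic without zeros, so multiplying by it preserves the normal form, in
particular the value 0 at poles. -/
theorem IsMeromorphicContinuation.const_mul {f G : ℂ → ℂ} (hG : IsMeromorphicContinuation f G)
    {c : ℂ} (hc : c ≠ 0) :
    IsMeromorphicContinuation (fun z => c * f z) (fun z => c * G z) :=
  ⟨(meromorphicNFOn_mul_iff_right_of_analyticOnNhd (g := fun _ => c) (U := Set.univ)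
    analyticOnNhd_const fun _ _ => hc).2 hG.1, fun s hs => congrArg (c * ·) (hG.2 s hs)⟩

/-- The value of `eisAna` is that of any meromorphic continuation of `eisIntegral`. -/
theorem eisAna_eq_of_isMeromorphicContinuation {μ : Measure (IdeleClassGroup F)}
    {ω : UnitaryHeckeCharacter F} {φ : (Fin 2 → Adele F) → ℂ} {g : GL (Fin 2) (Adele F)}
    {G : ℂ → ℂ} (hG : IsMeromorphicContinuation (fun z => eisIntegral μ ω z φ g) G) (s : ℂ) :
    eisAna μ ω s φ g = G s := by
  unfold eisAna
  split_ifs with h1 h2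
  · exact (hG.2 s h1).symm
  · exact congrFun ((Classical.choose_spec h2).unique hG) s
  · exact absurd ⟨G, hG⟩ h2

/-- A proportionality of the integrals extends to their meromorphic continuations. -/
theorem eisAna_eq_mul_of_eisIntegral {μ : Measure (IdeleClassGroup F)}
    {ω : UnitaryHeckeCharacter F} {φ : (Fin 2 → Adele F) → ℂ} {g g' : GL (Fin 2) (Adele F)}
    {c : ℂ} (hc : c ≠ 0) (h : ∀ s, eisIntegral μ ω s φ g' = c * eisIntegral μ ω s φ g) (s : ℂ) :
    eisAna μ ω s φ g' = c * eisAna μ ω s φ g := by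
  by_cases hex : ∃ G, IsMeromorphicContinuation (fun z => eisIntegral μ ω z φ g) G
  · obtain ⟨G, hG⟩ := hex
    have hG' := hG.const_mul hc
    simp only [← h] at hG'
    rw [eisAna_eq_of_isMeromorphicContinuation hG, eisAna_eq_of_isMeromorphicContinuation hG']
  -- Multiplication by c⁻¹ would carry a continuation for g' back to one for g. So both are missing,
  -- and both values are the integral for Re s > 1 and 0 elsewhere.
  · have hex' : ¬∃ G, IsMeromorphicContinuation (fun z => eisIntegral μ ω z φ g') G := by
      rintro ⟨G, hG⟩
      have hG' := hG.const_mul (inv_ne_zero hc)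
      simp only [h, inv_mul_cancel_left₀ hc] at hG'
      exact hex ⟨_, hG'⟩
    unfold eisAna
    rw [dif_neg hex, dif_neg hex', h]
    split_ifs <;> simp

end Continuation

/-! ### Theta functions, left invariance and central character -/

section Theta

open Matrix

variable {F : Type*} [Field F] [NumberField F]

theorem glAct_mul (g h : GL (Fin 2) (Adele F)) (φ : (Fin 2 → Adele F) → ℂ) :
    glAct (g * h) φ = glAct g (glAct h φ) := by
  funext x
  unfold glAct
  rw [_root_.mul_inv_rev, Units.val_mul, Matrix.mulVec_mulVec]

theorem theta_mul (φ : (Fin 2 → Adele F) → ℂ) (g h : GL (Fin 2) (Adele F)) :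
    theta φ (g * h) = theta (glAct h φ) g := by
  simp only [theta, glAct_mul]

theorem theta_const_mul (c : ℂ) (φ : (Fin 2 → Adele F) → ℂ) (g : GL (Fin 2) (Adele F)) :
    theta (fun x => c * φ x) g = c * theta φ g := by
  simp only [theta, glAct, tsum_mul_left]

theorem vecDiag_mulVec (γ : Matrix (Fin 2) (Fin 2) F) (v : Fin 2 → F) :
    vecDiag (γ *ᵥ v) = γ.map (algebraMap F (Adele F)) *ᵥ vecDiag v := by
  funext j
  simp [vecDiag, Matrix.mulVec, dotProduct]

/-- The permutation `v ↦ γ⁻¹ v` of `F² \ {0}`. -/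
def nonzeroVecEquiv (γ : GL (Fin 2) F) :
    {v : Fin 2 → F // v ≠ 0} ≃ {v : Fin 2 → F // v ≠ 0} :=
  (Matrix.toLin'OfInv γ.mul_inv γ.inv_mul).toEquiv.subtypeEquiv fun _ =>
    (LinearEquiv.map_ne_zero_iff (Matrix.toLin'OfInv γ.mul_inv γ.inv_mul)).symm

/-- Since (γg)⁻¹v = g⁻¹(γ⁻¹v), this is a reindexing of the sum, valid without summability. -/
theorem theta_glDiag_mul (φ : (Fin 2 → Adele F) → ℂ) (γ : GL (Fin 2) F)
    (g : GL (Fin 2) (Adele F)) : theta φ (glDiag F γ * g) = theta φ g := by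
  unfold theta
  rw [← (nonzeroVecEquiv γ).tsum_eq fun v : {v : Fin 2 → F // v ≠ 0} => glAct g φ (vecDiag v.1)]
  refine tsum_congr fun v => ?_
  have h : ((nonzeroVecEquiv γ) v).1 = (γ⁻¹ : GL (Fin 2) F).1 *ᵥ v.1 := by
    ext1 j
    simp [nonzeroVecEquiv, Matrix.toLin'OfInv]
  rw [h, vecDiag_mulVec, glAct_mul]
  unfold glAct
  rw [← map_inv]
  rfl

theorem commute_scalar (g : GL (Fin 2) (Adele F)) (t : Idele F) :
    g * Matrix.GeneralLinearGroup.scalar (Fin 2) t =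
      Matrix.GeneralLinearGroup.scalar (Fin 2) t * g := by
  ext i j
  fin_cases i <;> fin_cases j <;>
    simp [Matrix.mul_apply, Matrix.diagonal_apply, mul_comm]

theorem ideleNorm_det_glDiag (γ : GL (Fin 2) F) :
    ideleNorm F (Matrix.GeneralLinearGroup.det (glDiag F γ)) = 1 := by
  rw [← ideleNorm_principalIdele F (Matrix.GeneralLinearGroup.det γ)]
  congr 1
  exact Matrix.GeneralLinearGroup.map_det _ γ

/-- Complex powers are multiplicative on nonnegative reals; this is what allows |zt|^{2s} to be
split. -/
theorem ideleNorm_pos (t : Idele F) : 0 < ideleNorm F t := by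
  have h : 0 ≤ ideleNorm F t := by
    refine mul_nonneg ?_ (finprod_nonneg fun v => norm_nonneg _)
    rw [InfiniteAdeleRing.norm_def]
    positivity
  exact h.lt_of_ne ((Group.isUnit t).map (ideleNorm F)).ne_zero.symm

theorem eisIntegrand_mk (ω : UnitaryHeckeCharacter F) (s : ℂ) (φ : (Fin 2 → Adele F) → ℂ)
    (g : GL (Fin 2) (Adele F)) (t : Idele F) :
    eisIntegrand ω s φ g (ideleClass F t) = eisIntegrandIdele ω s φ g t := rfl

theorem ideleClass_surjective : Function.Surjective (ideleClass F) :=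
  QuotientGroup.mk'_surjective _

/-- The values `Θ(φ)(g/t)` and the idele norm of `det g` determine the integral. -/
theorem eisIntegral_eq_mul {μ : Measure (IdeleClassGroup F)} {φ : (Fin 2 → Adele F) → ℂ}
    {g g' : GL (Fin 2) (Adele F)} {c : ℂ}
    (hdet : ideleNorm F (Matrix.GeneralLinearGroup.det g') =
      ideleNorm F (Matrix.GeneralLinearGroup.det g))
    (h : ∀ t : Idele F, theta φ (g' * Matrix.GeneralLinearGroup.scalar (Fin 2) t) =
      c * theta φ (g * Matrix.GeneralLinearGroup.scalar (Fin 2) t))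
    (ω : UnitaryHeckeCharacter F) (s : ℂ) :
    eisIntegral μ ω s φ g' = c * eisIntegral μ ω s φ g := by
  unfold eisIntegral
  -- Constants leave the Bochner integral without any integrability, so s is unrestricted.
  rw [hdet, mul_left_comm c, ← MeasureTheory.integral_const_mul (μ := μ) c (eisIntegrand ω s φ g)]
  congr 1
  refine integral_congr_ae (Filter.Eventually.of_forall fun t => ?_)
  dsimp only
  obtain ⟨t, rfl⟩ := ideleClass_surjective t
  simp only [eisIntegrand_mk, eisIntegrandIdele, h]
  ring

theorem eisAna_glDiag_mul (μ : Measure (IdeleClassGroup F)) (ω : UnitaryHeckeCharacter F) (s : ℂ)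
    (φ : (Fin 2 → Adele F) → ℂ) (γ : GL (Fin 2) F) (g : GL (Fin 2) (Adele F)) :
    eisAna μ ω s φ (glDiag F γ * g) = eisAna μ ω s φ g := by
  rw [← one_mul (eisAna μ ω s φ g)]
  refine eisAna_eq_mul_of_eisIntegral one_ne_zero (eisIntegral_eq_mul ?_ (fun t => ?_) ω) s
  · rw [map_mul, map_mul, ideleNorm_det_glDiag, one_mul]
  · rw [mul_assoc, theta_glDiag_mul, one_mul]

/-- If `h` multiplies `φ` by the constant `c`, then right translation by `h` multiplies the
Eisenstein series by `c`. -/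
theorem eisAna_mul_right (μ : Measure (IdeleClassGroup F)) (ω : UnitaryHeckeCharacter F) (s : ℂ)
    {φ : (Fin 2 → Adele F) → ℂ} {h : GL (Fin 2) (Adele F)} {c : ℂ} (hc : c ≠ 0)
    (hdet : ideleNorm F (Matrix.GeneralLinearGroup.det h) = 1)
    (hφ : glAct h φ = fun x => c * φ x) (g : GL (Fin 2) (Adele F)) :
    eisAna μ ω s φ (g * h) = c * eisAna μ ω s φ g := by
  refine eisAna_eq_mul_of_eisIntegral hc (eisIntegral_eq_mul ?_ (fun t => ?_) ω) s
  · rw [map_mul, map_mul, hdet, mul_one]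
  · rw [mul_assoc, commute_scalar, ← mul_assoc, theta_mul, hφ, theta_const_mul]

/-- The theta factor does not change because zg/(zt) = g/t; only the character and the norm
contribute. -/
theorem eisIntegrand_scalar_mul (ω : UnitaryHeckeCharacter F) (s : ℂ)
    (φ : (Fin 2 → Adele F) → ℂ) (z : Idele F) (g : GL (Fin 2) (Adele F))
    (t : IdeleClassGroup F) :
    eisIntegrand ω s φ (Matrix.GeneralLinearGroup.scalar (Fin 2) z * g) (ideleClass F z * t) =
      (ω (ideleClass F z) : ℂ) * ((ideleNorm F z : ℝ) : ℂ) ^ (2 * s) *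
        eisIntegrand ω s φ g t := by
  obtain ⟨t, rfl⟩ := ideleClass_surjective t
  have hθ : Matrix.GeneralLinearGroup.scalar (Fin 2) z * g *
      Matrix.GeneralLinearGroup.scalar (Fin 2) (z * t)⁻¹ =
        g * Matrix.GeneralLinearGroup.scalar (Fin 2) t⁻¹ := by
    rw [← commute_scalar, mul_assoc, ← map_mul]
    congr 2
    rw [_root_.mul_inv_rev, mul_comm, inv_mul_cancel_right]
  rw [← map_mul, eisIntegrand_mk, eisIntegrand_mk]
  unfold eisIntegrandIdele
  rw [hθ, map_mul (ideleClass F), map_mul ω, map_mul (ideleNorm F), Circle.coe_mul,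
    Complex.ofReal_mul,
    Complex.mul_cpow_ofReal_nonneg (ideleNorm_pos z).le (ideleNorm_pos t).le]
  ring

theorem eisIntegral_scalar_mul (μ : Measure (IdeleClassGroup F)) [μ.IsMulLeftInvariant]
    (ω : UnitaryHeckeCharacter F) (s : ℂ)
    (φ : (Fin 2 → Adele F) → ℂ) (z : Idele F) (g : GL (Fin 2) (Adele F)) :
    eisIntegral μ ω s φ (Matrix.GeneralLinearGroup.scalar (Fin 2) z * g) =
      (ω (ideleClass F z) : ℂ) * eisIntegral μ ω s φ g := by
  have hdet : Matrix.GeneralLinearGroup.det (Matrix.GeneralLinearGroup.scalar (Fin 2) z) =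
      z * z := by
    ext1
    simp [sq]
  have hz : ((ideleNorm F z : ℝ) : ℂ) ≠ 0 := by exact_mod_cast (ideleNorm_pos z).ne'
  unfold eisIntegral
  -- Substitution t ↦ zt in the left-hand integral.
  rw [← integral_mul_left_eq_self _ (ideleClass F z)]
  simp only [eisIntegrand_scalar_mul]
  rw [integral_const_mul, map_mul, map_mul, hdet, map_mul, Complex.ofReal_mul,
    Complex.mul_cpow_ofReal_nonneg (mul_pos (ideleNorm_pos z) (ideleNorm_pos z)).le
      (ideleNorm_pos _).le, Complex.ofReal_mul,
    Complex.mul_cpow_ofReal_nonneg (ideleNorm_pos z).le (ideleNorm_pos z).le,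
    two_mul, Complex.cpow_add _ _ hz, Complex.cpow_neg]
  have hne : ((ideleNorm F z : ℝ) : ℂ) ^ s ≠ 0 := by simp [Complex.cpow_eq_zero_iff, hz]
  field_simp

theorem eisAna_scalar_mul (μ : Measure (IdeleClassGroup F)) [μ.IsMulLeftInvariant]
    (ω : UnitaryHeckeCharacter F) (s : ℂ)
    (φ : (Fin 2 → Adele F) → ℂ) (z : Idele F) (g : GL (Fin 2) (Adele F)) :
    eisAna μ ω s φ (Matrix.GeneralLinearGroup.scalar (Fin 2) z * g) =
      (ω (ideleClass F z) : ℂ) * eisAna μ ω s φ g :=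
  eisAna_eq_mul_of_eisIntegral (Circle.coe_ne_zero _)
    (fun s => eisIntegral_scalar_mul μ ω s φ z g) s

end Theta

/-! ### Compactness of GL₂(Ô) and its action on finite adelic vectors -/

section Compactness

variable (F : Type*) [Field F] [NumberField F]

open HeightOneSpectrum in
/-- Every integral element of the completion is congruent to an element of `𝓞 F` modulo the maximal
ideal. -/
theorem exists_sub_algebraMap_mem_maximalIdeal (v : HeightOneSpectrum (𝓞 F))
    (x : v.adicCompletionIntegers F) : ∃ r : 𝓞 F,
      x - algebraMap (𝓞 F) (v.adicCompletionIntegers F) r ∈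
        IsLocalRing.maximalIdeal (v.adicCompletionIntegers F) := by
  -- Two approximations: density of F gives y with v(x - y) < 1, so y is v-integral; then some r in
  -- `𝓞 F` has v(r - y) < 1. The ultrametric inequality combines them.
  obtain ⟨y, hy⟩ := (denseRange_algebraMap F v).exists_mem_open
    (Valued.isOpen_ball (v.adicCompletion F) (1 : MonoidWithZeroHom.ValueGroup₀ _) |>.preimage
      (continuous_const.sub continuous_id : Continuous fun z => (x : v.adicCompletion F) - z))
    ⟨x, by simp⟩
  have hy1 : Valued.v ((x : v.adicCompletion F) - algebraMap F (v.adicCompletion F) y) < 1 := by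
    simpa using hy
  have hy2 : v.valuation F y ≤ 1 := by
    rw [← valuedAdicCompletion_eq_valuation']
    have h := Valuation.map_sub_le (v := Valued.v) x.2 hy1.le
    rwa [sub_sub_cancel] at h
  obtain ⟨r, hr⟩ := exists_valuation_sub_lt_of_integer v hy2 1
  refine ⟨r, ?_⟩
  rw [IsLocalRing.mem_maximalIdeal, mem_nonunits_iff,
    HeightOneSpectrum.adicCompletionIntegers.isUnit_iff_valued_eq_one]
  refine ne_of_lt ?_
  have hr' : Valued.v (algebraMap F (v.adicCompletion F) (algebraMap (𝓞 F) F r - y)) < 1 := by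
    refine (valuedAdicCompletion_eq_valuation' v _).trans_lt ?_
    simpa using hr
  have h := Valuation.map_sub_lt (v := Valued.v) hy1 hr'
  rw [map_sub (algebraMap F (v.adicCompletion F)), sub_sub, add_sub_cancel] at h
  exact h

/-- By the preceding approximation the residue field is a quotient of the finite ring 𝓞/v. -/
theorem finite_residueField_adicCompletionIntegers (v : HeightOneSpectrum (𝓞 F)) :
    Finite (IsLocalRing.ResidueField (v.adicCompletionIntegers F)) := by
  have hfin : Finite (𝓞 F ⧸ v.asIdeal) := Ideal.finiteQuotientOfFreeOfNeBot _ v.ne_bot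
  let f : 𝓞 F →+* IsLocalRing.ResidueField (v.adicCompletionIntegers F) :=
    (IsLocalRing.residue _).comp (algebraMap (𝓞 F) (v.adicCompletionIntegers F))
  have hf : ∀ a ∈ v.asIdeal, f a = 0 := by
    intro a ha
    refine (IsLocalRing.residue_eq_zero_iff _).2 ?_
    rw [IsLocalRing.mem_maximalIdeal, mem_nonunits_iff,
      HeightOneSpectrum.adicCompletionIntegers.isUnit_iff_valued_eq_one]
    refine ne_of_lt ?_
    change Valued.v (((algebraMap (𝓞 F) F a : F)) : v.adicCompletion F) < 1
    rw [HeightOneSpectrum.valuedAdicCompletion_eq_valuation']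
    exact (v.valuation_lt_one_iff_mem a).2 ha
  refine Finite.of_surjective (Ideal.Quotient.lift v.asIdeal f hf) ?_
  refine Ideal.Quotient.lift_surjective_of_surjective _ hf fun y => ?_
  obtain ⟨x, rfl⟩ := IsLocalRing.residue_surjective y
  obtain ⟨r, hr⟩ := exists_sub_algebraMap_mem_maximalIdeal F v x
  refine ⟨r, ?_⟩
  rw [← IsLocalRing.residue_eq_zero_iff, map_sub, sub_eq_zero] at hr
  exact hr.symm

/-- A complete discrete valuation ring with finite residue field is compact. -/
instance compactSpace_adicCompletionIntegers (v : HeightOneSpectrum (𝓞 F)) :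
    CompactSpace (v.adicCompletionIntegers F) := by
  have h1 : CompleteSpace (v.adicCompletionIntegers F) :=
    (Valued.isClosed_valuationSubring (v.adicCompletion F)).completeSpace_coe
  have h2 := finite_residueField_adicCompletionIntegers F v
  have h3 : IsDiscreteValuationRing (v.adicCompletionIntegers F) := inferInstance
  open Valued.integer in
  exact compactSpace_iff_completeSpace_and_isDiscreteValuationRing_and_finite_residueField.2
    ⟨h1, h3, h2⟩

theorem continuous_intAdeleIncl : Continuous (intAdeleIncl F) :=
  (RestrictedProduct.isEmbedding_structureMap
    (R := fun v : HeightOneSpectrum (𝓞 F) => v.adicCompletion F)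
    (A := fun v => (v.adicCompletionIntegers F : Set (v.adicCompletion F)))
    (𝓕 := Filter.cofinite)).continuous

/-- The matrix ring over a product of compact rings is compact, and the unit group of a compact T₁
topological monoid is again compact. -/
instance compactSpace_glIntAdele : CompactSpace (GL (Fin 2) (IntAdele F)) := by
  have h1 : CompactSpace (Matrix (Fin 2) (Fin 2) (IntAdele F)) :=
    inferInstanceAs (CompactSpace (Fin 2 → Fin 2 → IntAdele F))
  have h2 : T1Space (Matrix (Fin 2) (Fin 2) (IntAdele F)) :=
    inferInstanceAs (T1Space (Fin 2 → Fin 2 → IntAdele F))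
  infer_instance

/-- The action of `GL₂(Ô)` on the column vectors over the finite adeles. -/
abbrev glIntMulAction : MulAction (GL (Fin 2) (IntAdele F)) (Fin 2 → FinAdele F) where
  smul h x := Matrix.mulVec (Matrix.GeneralLinearGroup.map (intAdeleIncl F) h).1 x
  one_smul x := by
    change Matrix.mulVec (Matrix.GeneralLinearGroup.map (intAdeleIncl F) 1).1 x = x
    rw [map_one, Units.val_one, Matrix.one_mulVec]
  mul_smul a b x := by
    change Matrix.mulVec (Matrix.GeneralLinearGroup.map (intAdeleIncl F) (a * b)).1 x =
      Matrix.mulVec (Matrix.GeneralLinearGroup.map (intAdeleIncl F) a).1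
        (Matrix.mulVec (Matrix.GeneralLinearGroup.map (intAdeleIncl F) b).1 x)
    rw [map_mul, Units.val_mul, Matrix.mulVec_mulVec]

attribute [local instance] glIntMulAction

theorem continuousSMul_glInt :
    ContinuousSMul (GL (Fin 2) (IntAdele F)) (Fin 2 → FinAdele F) where
  continuous_smul := by
    change Continuous fun p : GL (Fin 2) (IntAdele F) × (Fin 2 → FinAdele F) =>
      Matrix.mulVec (p.1.1.map (intAdeleIncl F)) p.2
    have := continuous_intAdeleIncl F
    exact ((Units.continuous_val.comp continuous_fst).matrix_map this).matrix_mulVec continuous_snd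

end Compactness

/-! ### Open stabilizers of locally constant functions -/

section Stabilizer

/-- The subgroup of the elements `g` with `f (g • x) = f x` for all `x`. -/
def invarianceSubgroup (G : Type*) {X Y : Type*} [Group G] [MulAction G X] (f : X → Y) :
    Subgroup G where
  carrier := {g | ∀ x, f (g • x) = f x}
  one_mem' x := by simp
  mul_mem' {a b} ha hb x := by rw [mul_smul, ha, hb]
  inv_mem' {a} ha x := by rw [← ha (a⁻¹ • x), smul_inv_smul]

/-- Local constancy gives invariance near each point of the support for g near 1, and compactness of
the support makes the neighbourhood of 1 uniform. -/
theorem isOpen_invarianceSubgroup {G X Y : Type*} [Group G] [TopologicalSpace G]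
    [IsTopologicalGroup G] [TopologicalSpace X] [MulAction G X] [ContinuousSMul G X] [Zero Y]
    {f : X → Y} (hf : IsLocallyConstant f) (hc : HasCompactSupport f) :
    IsOpen (invarianceSubgroup G f : Set G) := by
  refine Subgroup.isOpen_of_mem_nhds _ (g := 1) ?_
  have h : ∀ᶠ g in nhds (1 : G), ∀ x ∈ tsupport f, f (g • x) = f x := by
    refine hc.eventually_forall_of_forall_eventually fun x _ => ?_
    have h1 : ∀ᶠ p : G × X in nhds (1, x), f (p.1 • p.2) = f x := by
      have : Filter.Tendsto (fun p : G × X => p.1 • p.2) (nhds (1, x)) (nhds x) := by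
        simpa using (continuous_smul (M := G) (X := X)).tendsto (1, x)
      exact this.eventually (hf.eventually_eq x)
    have h2 : ∀ᶠ p : G × X in nhds (1, x), f p.2 = f x :=
      (continuous_snd.tendsto (1, x)).eventually (hf.eventually_eq x)
    filter_upwards [h1, h2] with p hp hp'
    rw [hp, hp']
  -- Invariance under g⁻¹ on the support handles the points x outside the support that g moves into
  -- it.
  have h' : ∀ᶠ g in nhds (1 : G), ∀ x ∈ tsupport f, f (g⁻¹ • x) = f x :=
    (continuous_inv.tendsto' (1 : G) 1 inv_one).eventually h
  filter_upwards [h, h'] with g hg hg' x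
  by_cases hx : x ∈ tsupport f
  · exact hg x hx
  · by_cases hgx : g • x ∈ tsupport f
    · rw [← hg' _ hgx, inv_smul_smul]
    · rw [image_eq_zero_of_notMem_tsupport hx, image_eq_zero_of_notMem_tsupport hgx]

end Stabilizer

/-! ### Components of adelic matrices, weights and level -/

section Components

open Matrix

theorem glProd_mulVec {R S : Type*} [CommRing R] [CommRing S] (g : GL (Fin 2) R)
    (h : GL (Fin 2) S) (x : Fin 2 → R × S) (j : Fin 2) :
    ((glProd g h).1 *ᵥ x) j =
      ((g.1 *ᵥ fun i => (x i).1) j, (h.1 *ᵥ fun i => (x i).2) j) := by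
  ext <;> simp [glProd, Matrix.mulVec, dotProduct]

theorem glProd_det {R S : Type*} [CommRing R] [CommRing S] (g : GL (Fin 2) R)
    (h : GL (Fin 2) S) :
    (glProd g h).1.det = (g.1.det, h.1.det) :=
  Prod.ext ((RingHom.fst R S).map_det (glProd g h).1) ((RingHom.snd R S).map_det (glProd g h).1)

theorem rotationReal_inv {I : Type*} (θ : I → ℝ) :
    (rotationReal θ)⁻¹ = rotationReal (-θ) := by
  refine inv_eq_of_mul_eq_one_right ?_
  ext i j ι
  have h := Real.sin_sq_add_cos_sq (θ ι)
  fin_cases i <;> fin_cases j <;> simp [rotationReal, Matrix.mul_apply] <;> linarith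

theorem infAdeleEquiv_map_mulVec (F : Type*) [Field F] [IsTotallyReal F]
    (g : GL (Fin 2) (InfinitePlace F → ℝ))
    (y : Fin 2 → InfiniteAdeleRing F) (j : Fin 2) (ι : InfinitePlace F) :
    infAdeleEquiv F (((Matrix.GeneralLinearGroup.map
      ((infAdeleEquiv F).symm : (InfinitePlace F → ℝ) →+* _) g).1 *ᵥ y) j) ι =
      g.1 j 0 ι * infAdeleEquiv F (y 0) ι + g.1 j 1 ι * infAdeleEquiv F (y 1) ι := by
  simp [Matrix.mulVec, dotProduct]

variable (F : Type*) [Field F] [NumberField F]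

theorem glAct_glAdele (g : GL (Fin 2) (InfiniteAdeleRing F)) (h : GL (Fin 2) (FinAdele F))
    (φ : (Fin 2 → Adele F) → ℂ) (x : Fin 2 → Adele F) :
    glAct (glAdele F g h) φ x = φ fun j =>
      ((g⁻¹.1 *ᵥ fun i => (x i).1) j, (h⁻¹.1 *ᵥ finPart F x) j) :=
  congrArg φ (funext fun j => glProd_mulVec g⁻¹ h⁻¹ x j)

/-- The determinant is a unit of Ô, hence of norm 1 at each finite place, and is 1 at the infinite
places. -/
theorem ideleNorm_det_glInt (h : GL (Fin 2) (IntAdele F)) :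
    ideleNorm F (Matrix.GeneralLinearGroup.det (glInt F h)) = 1 := by
  have hdet : (Matrix.GeneralLinearGroup.det (glInt F h)).1 =
      ((1 : InfiniteAdeleRing F), intAdeleIncl F h.1.det) := by
    refine (glProd_det _ _).trans ?_
    rw [Units.val_one, Matrix.det_one, RingHom.map_det]
    rfl
  have h1 : ∀ v : HeightOneSpectrum (𝓞 F), ‖intAdeleIncl F h.1.det v‖ = 1 := by
    intro v
    have hu : IsUnit (h.1.det v) :=
      ((Matrix.isUnit_iff_isUnit_det _).1 h.isUnit).map (Pi.evalRingHom _ v)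
    have hv := HeightOneSpectrum.adicCompletionIntegers.isUnit_iff_valued_eq_one.1 hu
    refine (FinitePlace.norm_def _ _).trans ?_
    change ((WithZeroMulInt.toNNReal _ (Valued.v (h.1.det v).1) : NNReal) : ℝ) = 1
    rw [hv, map_one, NNReal.coe_one]
  have h2 : ∀ v : InfinitePlace F, ‖(1 : InfiniteAdeleRing F) v‖ = 1 :=
    fun v => norm_one (α := v.Completion)
  change ‖(Matrix.GeneralLinearGroup.det (glInt F h)).1.1‖ *
    ∏ᶠ v : HeightOneSpectrum (𝓞 F), ‖(Matrix.GeneralLinearGroup.det (glInt F h)).1.2 v‖ = 1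
  rw [hdet]
  simp [h1, InfiniteAdeleRing.norm_def, h2]


theorem ideleNorm_det_adelicRotation [IsTotallyReal F] (θ : InfinitePlace F → ℝ) :
    ideleNorm F (Matrix.GeneralLinearGroup.det (adelicRotation F θ)) = 1 := by
  have hdet : Matrix.GeneralLinearGroup.det (adelicRotation F θ) = 1 := by
    ext1
    refine (glProd_det _ _).trans (Prod.ext ?_ Matrix.det_one)
    refine (RingHom.map_det ((infAdeleEquiv F).symm :
      (InfinitePlace F → ℝ) →+* InfiniteAdeleRing F) (rotationReal θ).1).symm.trans ?_
    have h : (rotationReal θ).1.det = 1 := by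
      funext ι
      simp [rotationReal, Matrix.det_fin_two, ← sq]
    rw [h, map_one]
    rfl
  rw [hdet, map_one]

/-- The inverse rotation preserves v₁² + v₂², hence the Gaussian, and multiplies v₁ + iv₂ by e^{iθ},
whose k-th power is the weight factor. -/
theorem glAct_adelicRotation [IsTotallyReal F] (φf : (Fin 2 → FinAdele F) → ℂ)
    (k : InfinitePlace F → ℕ) (θ : InfinitePlace F → ℝ) :
    glAct (adelicRotation F θ) (weightFunction F φf k) = fun x =>
      (∏ ι : InfinitePlace F, Complex.exp (Complex.I * (k ι : ℂ) * (θ ι : ℂ))) *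
        weightFunction F φf k x := by
  funext x
  refine (glAct_glAdele F _ _ _ x).trans ?_
  have h0 : ∀ ι, infAdeleEquiv F (((Matrix.GeneralLinearGroup.map
      ((infAdeleEquiv F).symm : (InfinitePlace F → ℝ) →+* _) (rotationReal θ))⁻¹.1 *ᵥ
        fun i => (x i).1) 0) ι =
      Real.cos (θ ι) * infPart F x 0 ι - Real.sin (θ ι) * infPart F x 1 ι := by
    intro ι
    rw [← map_inv, infAdeleEquiv_map_mulVec, rotationReal_inv]
    simp [rotationReal, infPart, sub_eq_add_neg]
  have h1 : ∀ ι, infAdeleEquiv F (((Matrix.GeneralLinearGroup.map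
      ((infAdeleEquiv F).symm : (InfinitePlace F → ℝ) →+* _) (rotationReal θ))⁻¹.1 *ᵥ
        fun i => (x i).1) 1) ι =
      Real.sin (θ ι) * infPart F x 0 ι + Real.cos (θ ι) * infPart F x 1 ι := by
    intro ι
    rw [← map_inv, infAdeleEquiv_map_mulVec, rotationReal_inv]
    simp [rotationReal, infPart]
  have hfin : (((1 : GL (Fin 2) (FinAdele F))⁻¹).1 *ᵥ finPart F x) = finPart F x := by
    rw [inv_one, Units.val_one, Matrix.one_mulVec]
  unfold weightFunction
  rw [mul_left_comm, ← Finset.prod_mul_distrib]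
  refine congrArg₂ (· * ·) (congrArg φf hfin) (Finset.prod_congr rfl fun ι _ => ?_)
  unfold infPart at h0 h1 ⊢
  dsimp only
  rw [h0, h1]
  generalize infAdeleEquiv F (x 0).1 ι = a
  generalize infAdeleEquiv F (x 1).1 ι = b
  have hsq : (Real.cos (θ ι) * a - Real.sin (θ ι) * b) ^ 2 +
      (Real.sin (θ ι) * a + Real.cos (θ ι) * b) ^ 2 = a ^ 2 + b ^ 2 := by
    linear_combination (a ^ 2 + b ^ 2) * Real.sin_sq_add_cos_sq (θ ι)
  have hlin : ((Real.cos (θ ι) * a - Real.sin (θ ι) * b : ℝ) : ℂ) +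
      Complex.I * ((Real.sin (θ ι) * a + Real.cos (θ ι) * b : ℝ) : ℂ) =
        Complex.exp (θ ι * Complex.I) * (a + Complex.I * b) := by
    rw [Complex.exp_mul_I]
    push_cast
    linear_combination (-(b : ℂ) * Complex.sin (θ ι)) * Complex.I_sq
  rw [hsq, hlin, mul_pow, ← Complex.exp_nat_mul]
  ring_nf

/-- A Schwartz-Bruhat function is fixed by a subgroup of finite index of `GL₂(Ô)`. -/
theorem exists_finiteIndex_glAct_glInt [IsTotallyReal F] {φ : (Fin 2 → Adele F) → ℂ}
    (hφ : φ ∈ SchwartzBruhat F) :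
    ∃ K : Subgroup (GL (Fin 2) (IntAdele F)), K.FiniteIndex ∧
      ∀ h ∈ K, glAct (glInt F h) φ = φ := by
  induction hφ using Submodule.span_induction with
  | mem φ hφ =>
    obtain ⟨φf, φinf, hlc, hcs, rfl⟩ := hφ
    let := glIntMulAction F
    have := continuousSMul_glInt F
    refine ⟨invarianceSubgroup _ φf, ?_, fun h hh => ?_⟩
    -- An open subgroup of a compact group has finite index.
    · have := Subgroup.quotient_finite_of_isOpen _
        (isOpen_invarianceSubgroup (G := GL (Fin 2) (IntAdele F)) hlc hcs)
      exact Subgroup.finiteIndex_of_finite_quotient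
    · funext x
      refine (glAct_glAdele F _ _ _ x).trans ?_
      -- The action on functions goes through h⁻¹, hence `inv_mem`; the archimedean component of h
      -- is the identity.
      refine congrArg₂ (· * ·) (inv_mem hh (finPart F x)) (congrArg φinf ?_)
      funext j
      simp [infPart]
  | zero => exact ⟨⊤, inferInstance, fun h _ => rfl⟩
  | add φ ψ _ _ hφ hψ =>
    obtain ⟨K, hK, hφ⟩ := hφ
    obtain ⟨L, hL, hψ⟩ := hψ
    exact ⟨K ⊓ L, inferInstance, fun h hh =>
      congrArg₂ (· + ·) (hφ h hh.1) (hψ h hh.2)⟩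
  | smul c φ _ hφ =>
    obtain ⟨K, hK, hφ⟩ := hφ
    exact ⟨K, hK, fun h hh => congrArg (c • ·) (hφ h hh)⟩

end Components

end

theorem mainTheorem5 (F : Type*) [Field F] [NumberField F] [IsTotallyReal F]
    (μ : Measure (IdeleClassGroup F)) [μ.IsHaarMeasure]
    (φ : (Fin 2 → Adele F) → ℂ) (hφ : φ ∈ SchwartzBruhat F) :
    -- left invariance under `GL₂(F)`
    (∀ (ω : UnitaryHeckeCharacter F) (s : ℂ) (γ : Matrix.GeneralLinearGroup (Fin 2) F)
      (g : Matrix.GeneralLinearGroup (Fin 2) (Adele F)),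
      eisAna μ ω s φ (glDiag F γ * g) = eisAna μ ω s φ g) ∧
    -- the central character is `ω`
    (∀ (ω : UnitaryHeckeCharacter F) (s : ℂ) (z : Idele F)
      (g : Matrix.GeneralLinearGroup (Fin 2) (Adele F)),
      eisAna μ ω s φ (Matrix.GeneralLinearGroup.scalar (Fin 2) z * g) =
        (ω (ideleClass F z) : ℂ) * eisAna μ ω s φ g) ∧
    -- the weight at the infinite places
    (∀ (φf : (Fin 2 → FinAdele F) → ℂ) (k : InfinitePlace F → ℕ), φ = weightFunction F φf k →
      ∀ (ω : UnitaryHeckeCharacter F) (s : ℂ) (θ : InfinitePlace F → ℝ)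
        (g : Matrix.GeneralLinearGroup (Fin 2) (Adele F)),
        eisAna μ ω s φ (g * adelicRotation F θ) =
          (∏ ι : InfinitePlace F, Complex.exp (Complex.I * (k ι : ℂ) * (θ ι : ℂ))) *
            eisAna μ ω s φ g) ∧
    -- the level
    (∃ K : Subgroup (Matrix.GeneralLinearGroup (Fin 2) (IntAdele F)), K.FiniteIndex ∧
      ∀ (ω : UnitaryHeckeCharacter F) (s : ℂ), ∀ h ∈ K,
        ∀ g : Matrix.GeneralLinearGroup (Fin 2) (Adele F),
          eisAna μ ω s φ (g * glInt F h) = eisAna μ ω s φ g) := by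
  refine ⟨fun ω s γ g => eisAna_glDiag_mul μ ω s φ γ g,
    fun ω s z g => eisAna_scalar_mul μ ω s φ z g, ?_, ?_⟩
  · rintro φf k rfl ω s θ g
    exact eisAna_mul_right μ ω s (Finset.prod_ne_zero_iff.2 fun ι _ => Complex.exp_ne_zero _)
      (ideleNorm_det_adelicRotation F θ) (glAct_adelicRotation F φf k θ) g
  · obtain ⟨K, hK, h⟩ := exists_finiteIndex_glAct_glInt F hφ
    refine ⟨K, hK, fun ω s k hk g => ?_⟩
    rw [eisAna_mul_right μ ω s one_ne_zero (ideleNorm_det_glInt F k)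
      ((h k hk).trans (funext fun x => (one_mul _).symm)) g, one_mul]
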